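/- Let $\Sigma$ be an alphabet and $\Xi=\{x_1,x_2,x_3\}$ a set of three unknowns. A (coefficient-free) word equation $E: u=v$ on three unknowns is a pair of words $u,v\in\Xi^*$; its length is $|E|=|uv|$. A solution of $E$ is a monoid morphism $h:\Xi^*\to\Sigma^*$ with $h(u)=h(v)$. The rank of a morphism $h$ is the smallest $r$ for which there is a set $A$ of $r$ words over $\Sigma$ such that $h(x)\in A^*$ for every $x\in\Xi$; $h$ is periodic if its rank is at most one. A system $E_1,\dots,E_m$ is independent if for every $i$ there is a morphism $\Xi^*\to\Sigma^*$ that is not a solution of $E_i$ but is a solution of all the other equations; a sequence $E_1,\dots,E_m$ is a chain if for every $i$ there is a morphism $\Xi^*\to\Sigma^*$ that is not a solution of $E_i$ but is a solution of all the preceding equations $E_1,\dots,E_{i-1}$. Let $m\ge 1$ and let $E_1,\dots,E_m$ be word equations on three unknowns. (a) If $E_1,\dots,E_m$ is an independent system and the equations have a common nonperiodic solution, then $m\le |E_1|^2+1$. (b) If $E_1,\dots,E_m$ is a chain, then $m\le |E_1|^2+5$. -/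

import Mathlib

/-- A coefficient-free word equation `lhs = rhs` on the `n` unknowns indexed by `Fin n`. -/
structure WordEquation (n : ℕ) where
  lhs : FreeMonoid (Fin n)
  rhs : FreeMonoid (Fin n)

namespace WordEquation

/-- The length of the equation `u = v` is the length of the word `uv`. -/
def length {n : ℕ} (E : WordEquation n) : ℕ :=
  (E.lhs * E.rhs).length

/-- The morphism `h` from words over the unknowns to words over the alphabet `α`
is a solution of the equation `E`. -/
def IsSolution {n : ℕ} {α : Type*} (E : WordEquation n)
    (h : FreeMonoid (Fin n) →* FreeMonoid α) : Prop :=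
  h E.lhs = h E.rhs

/-- The combinatorial rank of a morphism: the smallest cardinality of a set `A` of words such
that the image of every unknown is a product of words of `A`. -/
noncomputable def morphismRank {n : ℕ} {α : Type*}
    (h : FreeMonoid (Fin n) →* FreeMonoid α) : ℕ :=
  sInf {r : ℕ | ∃ A : Finset (FreeMonoid α), A.card = r ∧
    ∀ x : Fin n, h (FreeMonoid.of x) ∈ Submonoid.closure (A : Set (FreeMonoid α))}

/-- A morphism is periodic if its rank is at most one. -/
def IsPeriodic {n : ℕ} {α : Type*} (h : FreeMonoid (Fin n) →* FreeMonoid α) : Prop :=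
  morphismRank h ≤ 1

/-- A system is independent (over the alphabet `α`) if for every `i` some morphism is not a
solution of the `i`-th equation, but is a solution of all the other equations. -/
def IsIndependentSystem {n m : ℕ} (α : Type*) (E : Fin m → WordEquation n) : Prop :=
  ∀ i, ∃ h : FreeMonoid (Fin n) →* FreeMonoid α,
    ¬ (E i).IsSolution h ∧ ∀ j, j ≠ i → (E j).IsSolution h

/-- A sequence of equations is a chain (over the alphabet `α`) if for every `i` some morphism is
not a solution of the `i`-th equation, but is a solution of all the preceding equations. -/
def IsChainOfEquations {n m : ℕ} (α : Type*) (E : Fin m → WordEquation n) : Prop :=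
  ∀ i, ∃ h : FreeMonoid (Fin n) →* FreeMonoid α,
    ¬ (E i).IsSolution h ∧ ∀ j, j < i → (E j).IsSolution h

end WordEquation

/-! A nonperiodic solution `h` of a nontrivial equation on three unknowns factors as `f.comp g`,
where `g` takes values in words over two letters and has independent rows of letter counts, and `f`
is injective; so `h` and `g` solve the same equations (`exists_hasRankTwo`).

Free differential calculus makes this linear. After substitution by `g`, the vector of Fox
polynomials of an equation is orthogonal to two independent rows exactly when `g` solves the
equation. In dimension three the orthogonal complement is a line, so if `g` solves a nontrivial `E`,
it solves `F` iff the substitution kills the two by two minors of `E` and `F`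
(`HasRankTwo.isSolution_iff_minor`).

Let `M` be a nonzero minor. If the substitution kills `M`, some minimal positive exponent `p` and
minimal negative exponent `q` have the same image (`exists_push_eq`). Then `p - q` spans the kernel
of the letter count matrix of `g`. This kernel determines which monomials collide, hence which
equations `g` solves. Minimal exponents of one sign form an antichain with at most `|E|` members
(`card_minPos_minor_le`), so there are at most `|E| ^ 2` classes of common solutions
(`card_le_length_sq`).

In a chain, the remaining equations are the first, the one used as `F`, and at most three with
periodic witnesses. In an independent system, the common nonperiodic solution supplies a further
class, which makes up for the equation used as `F`. -/

namespace WordEquation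

open MvPolynomial

/-! ### Elementary morphisms and the defect effect -/

section Elimination

variable {ι α : Type*}

/-- The morphism sending the letter `b` to `ab` and fixing all other letters. -/
def elementary [DecidableEq ι] (a b : ι) : FreeMonoid ι →* FreeMonoid ι :=
  FreeMonoid.lift fun i => if i = b then FreeMonoid.of a * FreeMonoid.of b else FreeMonoid.of i

theorem of_mul_ne_of_mul {i j : ι} (hij : i ≠ j) (u v : FreeMonoid ι) :
    FreeMonoid.of i * u ≠ FreeMonoid.of j * v := fun h =>
  hij (List.cons.inj (congrArg FreeMonoid.toList h)).1

theorem of_mul_ne_one (i : ι) (u : FreeMonoid ι) : FreeMonoid.of i * u ≠ 1 := fun h =>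
  List.cons_ne_nil _ _ (congrArg FreeMonoid.toList h)

theorem elementary_of_ne [DecidableEq ι] {a b i : ι} (h : i ≠ b) :
    elementary a b (FreeMonoid.of i) = FreeMonoid.of i := by
  simp [elementary, h]

theorem elementary_of_self [DecidableEq ι] (a b : ι) :
    elementary a b (FreeMonoid.of b) = FreeMonoid.of a * FreeMonoid.of b := by
  simp [elementary]

theorem elementary_ne_of_mul [DecidableEq ι] {a b : ι} (hab : a ≠ b) (u v : FreeMonoid ι) :
    elementary a b u ≠ FreeMonoid.of b * v := by
  induction u using FreeMonoid.casesOn with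
  | one => rw [map_one]; exact (of_mul_ne_one b v).symm
  | of_mul i u =>
    rw [map_mul]
    by_cases hi : i = b
    · rw [hi, elementary_of_self, mul_assoc]
      exact of_mul_ne_of_mul hab _ _
    · rw [elementary_of_ne hi]
      exact of_mul_ne_of_mul hi _ _

theorem elementary_of_mul_eq [DecidableEq ι] (a b i : ι) (u : FreeMonoid ι) :
    ∃ w, elementary a b (FreeMonoid.of i * u) = FreeMonoid.of (if i = b then a else i) * w := by
  by_cases hi : i = b
  · refine ⟨FreeMonoid.of b * elementary a b u, ?_⟩
    rw [map_mul, hi, elementary_of_self, if_pos rfl, mul_assoc]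
  · refine ⟨elementary a b u, ?_⟩
    rw [map_mul, elementary_of_ne hi, if_neg hi]

/-- Decoding looks one letter ahead: no image begins with `b`, so an initial `a` followed by `b` can
only come from the letter `b`. -/
theorem elementary_injective [DecidableEq ι] {a b : ι} (hab : a ≠ b) :
    Function.Injective (elementary a b) := by
  intro u
  induction u using FreeMonoid.inductionOn' with
  | one =>
    intro v h
    induction v using FreeMonoid.casesOn with
    | one => rfl
    | of_mul j v =>
      obtain ⟨w, hw⟩ := elementary_of_mul_eq a b j v
      rw [map_one, hw] at h
      exact absurd h.symm (of_mul_ne_one _ _)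
  | of_mul i u ih =>
    intro v h
    induction v using FreeMonoid.casesOn with
    | one =>
      obtain ⟨w, hw⟩ := elementary_of_mul_eq a b i u
      rw [map_one, hw] at h
      exact absurd h (of_mul_ne_one _ _)
    | of_mul j v =>
      by_cases hij : i = j
      · subst hij
        rw [map_mul, map_mul] at h
        rw [ih (mul_left_cancel h)]
      · exfalso
        by_cases hi : i = b
        · subst hi
          rw [map_mul, map_mul, elementary_of_self, elementary_of_ne (Ne.symm hij), mul_assoc] at h
          by_cases hj : j = a
          · subst hj
            exact elementary_ne_of_mul hab _ _ (mul_left_cancel h).symm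
          · exact of_mul_ne_of_mul (Ne.symm hj) _ _ h
        · by_cases hj : j = b
          · subst hj
            rw [map_mul, map_mul, elementary_of_self, elementary_of_ne hi, mul_assoc] at h
            by_cases hi' : i = a
            · subst hi'
              exact elementary_ne_of_mul hab _ _ (mul_left_cancel h)
            · exact of_mul_ne_of_mul hi' _ _ h
          · rw [map_mul, map_mul, elementary_of_ne hi, elementary_of_ne hj] at h
            exact of_mul_ne_of_mul hij _ _ h

theorem eq_mul_or_eq_mul_of_mul_eq_mul {p q s t : FreeMonoid α} (h : p * s = q * t) :
    (∃ c, q = p * c) ∨ ∃ c, p = q * c := by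
  rcases List.append_eq_append_iff.1 (show p.toList ++ s.toList = q.toList ++ t.toList from h) with
    ⟨c, hc, -⟩ | ⟨c, hc, -⟩
  · exact Or.inl ⟨FreeMonoid.ofList c, hc⟩
  · exact Or.inr ⟨FreeMonoid.ofList c, hc⟩

/-- A nonerasing morphism identifying two distinct words maps some letter to a prefix of the
image of another letter. -/
theorem exists_prefix_of_not_injective {h : FreeMonoid ι →* FreeMonoid α}
    (h1 : ∀ a, h (FreeMonoid.of a) ≠ 1) {u v : FreeMonoid ι} (huv : u ≠ v) (he : h u = h v) :
    ∃ a b c, a ≠ b ∧ h (FreeMonoid.of b) = h (FreeMonoid.of a) * c := by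
  induction u using FreeMonoid.inductionOn' generalizing v with
  | one =>
    induction v using FreeMonoid.casesOn with
    | one => exact absurd rfl huv
    | of_mul j v =>
      rw [map_one, map_mul] at he
      have := congrArg FreeMonoid.length he
      rw [FreeMonoid.length_mul, FreeMonoid.length_one] at this
      exact absurd (FreeMonoid.length_eq_zero.1 (by omega)) (h1 j)
  | of_mul i u ih =>
    induction v using FreeMonoid.casesOn with
    | one =>
      rw [map_one, map_mul] at he
      have := congrArg FreeMonoid.length he
      rw [FreeMonoid.length_mul, FreeMonoid.length_one] at this
      exact absurd (FreeMonoid.length_eq_zero.1 (by omega)) (h1 i)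
    | of_mul j v =>
      rw [map_mul, map_mul] at he
      by_cases hij : i = j
      · subst hij
        exact ih (fun e => huv (by rw [e])) (mul_left_cancel he)
      · rcases eq_mul_or_eq_mul_of_mul_eq_mul he with ⟨c, hc⟩ | ⟨c, hc⟩
        · exact ⟨i, j, c, hij, hc⟩
        · exact ⟨j, i, c, Ne.symm hij, hc⟩

/-- A nonerasing morphism identifying two distinct words factors through an elementary morphism,
the other factor being shorter. -/
theorem exists_comp_elementary [Fintype ι] [DecidableEq ι] {h : FreeMonoid ι →* FreeMonoid α}
    (h1 : ∀ a, h (FreeMonoid.of a) ≠ 1) {u v : FreeMonoid ι} (huv : u ≠ v) (he : h u = h v) :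
    ∃ (a b : ι) (h' : FreeMonoid ι →* FreeMonoid α), a ≠ b ∧ h = h'.comp (elementary a b) ∧
      ∑ i, (h' (FreeMonoid.of i)).length < ∑ i, (h (FreeMonoid.of i)).length := by
  obtain ⟨a, b, c, hab, hc⟩ := exists_prefix_of_not_injective h1 huv he
  refine ⟨a, b, FreeMonoid.lift (Function.update (fun i => h (FreeMonoid.of i)) b c), hab, ?_, ?_⟩
  · refine FreeMonoid.hom_eq fun i => ?_
    by_cases hi : i = b
    · subst hi
      simp [elementary_of_self, hc, hab]
    · simp [elementary_of_ne hi, hi]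
  · have hlen : (h (FreeMonoid.of b)).length = (h (FreeMonoid.of a)).length + c.length := by
      rw [hc, FreeMonoid.length_mul]
    have hpos : 0 < (h (FreeMonoid.of a)).length :=
      Nat.pos_of_ne_zero fun e => h1 a (FreeMonoid.length_eq_zero.1 e)
    refine Finset.sum_lt_sum (fun i _ => ?_) ⟨b, Finset.mem_univ b, ?_⟩
    · by_cases hi : i = b
      · subst hi
        simp only [FreeMonoid.lift_eval_of, Function.update_self]
        omega
      · simp [hi]
    · simp only [FreeMonoid.lift_eval_of, Function.update_self]
      omega

/-- All values of the morphism on letters are powers of a single word. -/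
def IsPowerMorphism (h : FreeMonoid ι →* FreeMonoid α) : Prop :=
  ∃ w : FreeMonoid α, ∀ i, ∃ k : ℕ, h (FreeMonoid.of i) = w ^ k

theorem IsPowerMorphism.comp {κ : Type*} {h : FreeMonoid ι →* FreeMonoid α}
    (hh : IsPowerMorphism h) (g : FreeMonoid κ →* FreeMonoid ι) : IsPowerMorphism (h.comp g) := by
  obtain ⟨w, hw⟩ := hh
  have key : ∀ u : FreeMonoid ι, ∃ k : ℕ, h u = w ^ k := by
    intro u
    induction u using FreeMonoid.inductionOn' with
    | one => exact ⟨0, by simp⟩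
    | of_mul i u ih =>
      obtain ⟨k, hk⟩ := ih
      obtain ⟨l, hl⟩ := hw i
      exact ⟨l + k, by rw [map_mul, hk, hl, pow_add]⟩
  exact ⟨w, fun i => key _⟩

/-- Two words satisfying a nontrivial relation are powers of a common word. -/
theorem isPowerMorphism_of_eq (f : FreeMonoid Bool →* FreeMonoid α) {u v : FreeMonoid Bool}
    (huv : u ≠ v) (he : f u = f v) : IsPowerMorphism f := by
  induction hn : ∑ i, (f (FreeMonoid.of i)).length using Nat.strong_induction_on
    generalizing f u v with
  | _ n ih =>
    by_cases h1 : ∀ a, f (FreeMonoid.of a) ≠ 1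
    · obtain ⟨a, b, f', hab, rfl, hlt⟩ := exists_comp_elementary h1 huv he
      exact (ih _ (hn ▸ hlt) f' (fun e => huv (elementary_injective hab e)) he rfl).comp _
    · push Not at h1
      -- The descent on total length stops at an erased letter; the image of the other letter is
      -- then a common root.
      obtain ⟨a, ha⟩ := h1
      refine ⟨f (FreeMonoid.of (!a)), fun i => ?_⟩
      by_cases hi : i = a
      · exact ⟨0, by rw [hi, ha, pow_zero]⟩
      · exact ⟨1, by rw [pow_one, Bool.eq_not_of_ne hi]⟩

theorem isPeriodic_iff_isPowerMorphism {n : ℕ} (h : FreeMonoid (Fin n) →* FreeMonoid α) :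
    IsPeriodic h ↔ IsPowerMorphism h := by
  classical
  constructor
  · intro hp
    have hne : {r : ℕ | ∃ A : Finset (FreeMonoid α), A.card = r ∧
        ∀ x : Fin n, h (FreeMonoid.of x) ∈ Submonoid.closure (A : Set (FreeMonoid α))}.Nonempty :=
      ⟨_, Finset.univ.image fun x => h (FreeMonoid.of x), rfl, fun x =>
        Submonoid.subset_closure (by simp)⟩
    obtain ⟨A, hA, hx⟩ := Nat.sInf_mem hne
    have hA1 : A.card ≤ 1 := hA.trans_le hp
    obtain ⟨w, hw⟩ := Finset.card_le_one_iff_subset_singleton.1 hA1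
    refine ⟨w, fun i => ?_⟩
    have := Submonoid.closure_mono (Finset.coe_subset.2 hw) (hx i)
    rw [Finset.coe_singleton, Submonoid.mem_closure_singleton] at this
    obtain ⟨k, hk⟩ := this
    exact ⟨k, hk.symm⟩
  · rintro ⟨w, hw⟩
    refine Nat.sInf_le (show (1 : ℕ) ∈ _ from ⟨{w}, by simp, fun x => ?_⟩)
    rw [Finset.coe_singleton, Submonoid.mem_closure_singleton]
    obtain ⟨k, hk⟩ := hw x
    exact ⟨k, hk.symm⟩

end Elimination

/-! ### Reduction to two letters -/

section Rank

variable {α : Type*}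

/-- The number of occurrences of a letter. -/
def letterCount {κ : Type*} [DecidableEq κ] (b : κ) (w : FreeMonoid κ) : ℕ := w.toList.count b

theorem letterCount_mul {κ : Type*} [DecidableEq κ] (b : κ) (u v : FreeMonoid κ) :
    letterCount b (u * v) = letterCount b u + letterCount b v := List.count_append

theorem letterCount_one {κ : Type*} [DecidableEq κ] (b : κ) :
    letterCount b (1 : FreeMonoid κ) = 0 := rfl

theorem letterCount_of {κ : Type*} [DecidableEq κ] (b i : κ) :
    letterCount b (FreeMonoid.of i) = if i = b then 1 else 0 := by
  simp [letterCount, List.count_singleton]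

/-- The two rows of letter counts of the images of the unknowns are linearly independent. -/
def HasRankTwo {ι : Type*} (g : FreeMonoid ι →* FreeMonoid Bool) : Prop :=
  ∃ i j, letterCount true (g (FreeMonoid.of i)) * letterCount false (g (FreeMonoid.of j)) ≠
    letterCount true (g (FreeMonoid.of j)) * letterCount false (g (FreeMonoid.of i))

/-- Composition adds column `a` of the count matrix to column `b`, which preserves its rank. -/
theorem HasRankTwo.comp_elementary {ι : Type*} [DecidableEq ι]
    {g : FreeMonoid ι →* FreeMonoid Bool} (hg : HasRankTwo g) {a b : ι} (hab : a ≠ b) :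
    HasRankTwo (g.comp (elementary a b)) := by
  by_contra hcon
  unfold HasRankTwo at hcon
  push Not at hcon
  obtain ⟨i, j, hij⟩ := hg
  have hne : ∀ i, i ≠ b → (g.comp (elementary a b)) (FreeMonoid.of i) = g (FreeMonoid.of i) := by
    intro i hi
    rw [MonoidHom.comp_apply, elementary_of_ne hi]
  have hself : (g.comp (elementary a b)) (FreeMonoid.of b) =
      g (FreeMonoid.of a) * g (FreeMonoid.of b) := by
    rw [MonoidHom.comp_apply, elementary_of_self, map_mul]
  have key : ∀ i, i ≠ b →
      letterCount true (g (FreeMonoid.of i)) * letterCount false (g (FreeMonoid.of b)) =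
        letterCount true (g (FreeMonoid.of b)) * letterCount false (g (FreeMonoid.of i)) := by
    intro i hi
    have h1 := hcon i b
    have h2 := hcon i a
    rw [hne i hi, hself, letterCount_mul, letterCount_mul] at h1
    rw [hne i hi, hne a hab] at h2
    linarith
  apply hij
  by_cases hi : i = b
  · by_cases hj : j = b
    · rw [hi, hj]
    · rw [hi]; exact (key j hj).symm
  · by_cases hj : j = b
    · rw [hj]; exact key i hi
    · simpa only [hne i hi, hne j hj] using hcon i j

/-- Elementary factors are split off until some letter is erased. The two other letters then serve
as the free generators, and composing back preserves rank two. -/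
theorem exists_hasRankTwo_comp {h : FreeMonoid (Fin 3) →* FreeMonoid α}
    (hp : ¬ IsPowerMorphism h) {u v : FreeMonoid (Fin 3)} (huv : u ≠ v) (he : h u = h v) :
    ∃ (g : FreeMonoid (Fin 3) →* FreeMonoid Bool) (f : FreeMonoid Bool →* FreeMonoid α),
      HasRankTwo g ∧ h = f.comp g := by
  induction hn : ∑ i, (h (FreeMonoid.of i)).length using Nat.strong_induction_on
    generalizing h u v with
  | _ n ih =>
    by_cases h1 : ∀ a, h (FreeMonoid.of a) ≠ 1
    · obtain ⟨a, b, h', hab, rfl, hlt⟩ := exists_comp_elementary h1 huv he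
      obtain ⟨g, f, hg, rfl⟩ := ih _ (hn ▸ hlt) (fun e => hp (e.comp _))
        (fun e => huv (elementary_injective hab e)) he rfl
      exact ⟨g.comp (elementary a b), f, hg.comp_elementary hab, rfl⟩
    · push Not at h1
      obtain ⟨a, ha⟩ := h1
      obtain ⟨b, c, hba, hca, hbc⟩ : ∃ b c : Fin 3, b ≠ a ∧ c ≠ a ∧ b ≠ c := by
        clear ha; revert a; decide
      have hall : ∀ i : Fin 3, i = a ∨ i = b ∨ i = c := by
        revert hba hca hbc; clear ha; revert a b c; decide
      refine ⟨FreeMonoid.lift fun i => if i = a then 1 else FreeMonoid.of (decide (i = b)),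
        FreeMonoid.lift fun x => if x then h (FreeMonoid.of b) else h (FreeMonoid.of c),
        ⟨b, c, ?_⟩, FreeMonoid.hom_eq fun i => ?_⟩
      · simp [hba, hca, hbc.symm, letterCount_of]
      · rcases hall i with rfl | rfl | rfl
        · simp [ha]
        · simp [hba]
        · simp [hca, hbc.symm]

/-- A nonperiodic solution of a nontrivial equation can be replaced by a morphism to words over
two letters with linearly independent letter counts. -/
theorem exists_hasRankTwo {h : FreeMonoid (Fin 3) →* FreeMonoid α}
    (hp : ¬ IsPeriodic h) {u v : FreeMonoid (Fin 3)} (huv : u ≠ v) (he : h u = h v) :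
    ∃ g : FreeMonoid (Fin 3) →* FreeMonoid Bool, HasRankTwo g ∧
      ∀ E : WordEquation 3, E.IsSolution h ↔ E.IsSolution g := by
  rw [isPeriodic_iff_isPowerMorphism] at hp
  obtain ⟨g, f, hg, rfl⟩ := exists_hasRankTwo_comp hp huv he
  refine ⟨g, hg, fun E => ⟨fun hE => ?_, fun hE => congrArg f hE⟩⟩
  -- If `f` identified two distinct words, its values would be powers of one word and `h` would be
  -- periodic.
  by_contra hne
  exact hp ((isPowerMorphism_of_eq f hne hE).comp g)

end Rank

/-! ### Weighted prefix sums -/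

section FoxSum

variable {ι R : Type*} [CommRing R]

/-- The sum, over the letters of a word, of the value `δ` of the letter times the product of the
values `x` of the preceding letters. -/
def foxSum (x δ : ι → R) (w : FreeMonoid ι) : R :=
  w.toList.foldr (fun i r => δ i + x i * r) 0

theorem foxSum_one (x δ : ι → R) : foxSum x δ 1 = 0 := rfl

theorem foxSum_of_mul (x δ : ι → R) (i : ι) (w : FreeMonoid ι) :
    foxSum x δ (FreeMonoid.of i * w) = δ i + x i * foxSum x δ w := rfl

theorem foxSum_mul (x δ : ι → R) (u v : FreeMonoid ι) :
    foxSum x δ (u * v) = foxSum x δ u + FreeMonoid.lift x u * foxSum x δ v := by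
  induction u using FreeMonoid.inductionOn' with
  | one => simp [foxSum_one]
  | of_mul i u ih =>
    rw [mul_assoc, foxSum_of_mul, foxSum_of_mul, ih, map_mul, FreeMonoid.lift_eval_of]
    ring

theorem map_foxSum {S : Type*} [CommRing S] (φ : R →+* S) (x δ : ι → R) (w : FreeMonoid ι) :
    φ (foxSum x δ w) = foxSum (fun i => φ (x i)) (fun i => φ (δ i)) w := by
  induction w using FreeMonoid.inductionOn' with
  | one => simp [foxSum_one]
  | of_mul i u ih => rw [foxSum_of_mul, foxSum_of_mul, map_add, map_mul, ih]

theorem foxSum_eq_sum [Fintype ι] [DecidableEq ι] (x δ : ι → R) (w : FreeMonoid ι) :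
    foxSum x δ w = ∑ a, δ a * foxSum x (Pi.single a 1) w := by
  induction w using FreeMonoid.inductionOn' with
  | one => simp [foxSum_one]
  | of_mul i u ih =>
    simp only [foxSum_of_mul, mul_add, Finset.sum_add_distrib]
    congr 1
    · rw [Finset.sum_eq_single i]
      · simp
      · intro b _ hb; simp [hb.symm]
      · simp
    · rw [ih, Finset.mul_sum]
      exact Finset.sum_congr rfl fun a _ => by ring

theorem foxSum_apply_hom {κ : Type*} (g : FreeMonoid κ →* FreeMonoid ι) (x δ : ι → R)
    (w : FreeMonoid κ) :
    foxSum x δ (g w) = foxSum (fun i => FreeMonoid.lift x (g (FreeMonoid.of i)))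
      (fun i => foxSum x δ (g (FreeMonoid.of i))) w := by
  induction w using FreeMonoid.inductionOn' with
  | one => simp [foxSum_one]
  | of_mul i u ih => rw [map_mul, foxSum_mul, foxSum_of_mul, ih]

theorem foxSum_nonneg {x δ : ι → ℤ} (hx : ∀ i, 0 ≤ x i) (hδ : ∀ i, 0 ≤ δ i) (w : FreeMonoid ι) :
    0 ≤ foxSum x δ w := by
  induction w using FreeMonoid.inductionOn' with
  | one => exact le_of_eq (foxSum_one x δ).symm
  | of_mul i u ih =>
    rw [foxSum_of_mul]
    exact add_nonneg (hδ i) (mul_nonneg (hx i) ih)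

end FoxSum

/-! ### Fox polynomials -/

section Fox

variable {ι : Type*} [DecidableEq ι]

/-- The sum, over the occurrences of the letter `a` in a word, of the commutative images of the
prefixes preceding them. -/
noncomputable def fox (a : ι) (w : FreeMonoid ι) : MvPolynomial ι ℤ :=
  foxSum X (Pi.single a 1) w

theorem fox_one (a : ι) : fox a 1 = 0 := rfl

theorem fox_of_mul (a i : ι) (w : FreeMonoid ι) :
    fox a (FreeMonoid.of i * w) = Pi.single (M := fun _ => MvPolynomial ι ℤ) a 1 i + X i * fox a w :=
  rfl

theorem constantCoeff_fox_of_mul (a i : ι) (w : FreeMonoid ι) :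
    constantCoeff (fox a (FreeMonoid.of i * w)) = if i = a then 1 else 0 := by
  rw [fox_of_mul, map_add, map_mul, constantCoeff_X, zero_mul, add_zero, Pi.single_apply]
  split_ifs <;> simp

/-- The constant coefficients reveal the first letter, which can then be cancelled. -/
theorem eq_of_fox_eq {u v : FreeMonoid ι} (h : ∀ a, fox a u = fox a v) : u = v := by
  induction u using FreeMonoid.inductionOn' generalizing v with
  | one =>
    induction v using FreeMonoid.casesOn with
    | one => rfl
    | of_mul j v =>
      have := congrArg constantCoeff (h j)
      simp [constantCoeff_fox_of_mul, fox_one] at this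
  | of_mul i u ih =>
    induction v using FreeMonoid.casesOn with
    | one =>
      have := congrArg constantCoeff (h i)
      simp [constantCoeff_fox_of_mul, fox_one] at this
    | of_mul j v =>
      have hji : j = i := by
        by_contra hji
        have := congrArg constantCoeff (h i)
        simp [constantCoeff_fox_of_mul, hji] at this
      subst hji
      rw [ih fun a => ?_]
      have := h a
      rw [fox_of_mul, fox_of_mul] at this
      exact mul_left_cancel₀ (X_ne_zero j) (add_left_cancel this)

theorem eval_one_fox (a : ι) (w : FreeMonoid ι) :
    eval (fun _ => (1 : ℤ)) (fox a w) = letterCount a w := by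
  induction w using FreeMonoid.inductionOn' with
  | one => simp [fox_one, letterCount_one]
  | of_mul i u ih =>
    rw [fox_of_mul, map_add, map_mul, eval_X, one_mul, ih, letterCount_mul, letterCount_of,
      Pi.single_apply]
    split_ifs <;> simp

end Fox

/-! ### Orthogonal complements in dimension three -/

section Proportional

variable {R : Type*} [CommRing R] [IsDomain R]

/-- The cross product `N` of `a` and `b` is nonzero, and every vector orthogonal to both is
proportional to it. -/
theorem proportional_of_orthogonal {a b c d : Fin 3 → R}
    (hab : ∃ i j, a i * b j ≠ a j * b i)
    (hac : ∑ i, a i * c i = 0) (hbc : ∑ i, b i * c i = 0)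
    (had : ∑ i, a i * d i = 0) (hbd : ∑ i, b i * d i = 0) (i j : Fin 3) :
    c i * d j = c j * d i := by
  obtain ⟨N, h0, h1, h2⟩ : ∃ N : Fin 3 → R, N 0 = a 1 * b 2 - a 2 * b 1 ∧
      N 1 = a 2 * b 0 - a 0 * b 2 ∧ N 2 = a 0 * b 1 - a 1 * b 0 :=
    ⟨![a 1 * b 2 - a 2 * b 1, a 2 * b 0 - a 0 * b 2, a 0 * b 1 - a 1 * b 0], rfl, rfl, rfl⟩
  have key : ∀ x : Fin 3 → R, ∑ i, a i * x i = 0 → ∑ i, b i * x i = 0 →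
      ∀ i j, x i * N j = x j * N i := by
    intro x hax hbx
    rw [Fin.sum_univ_three] at hax hbx
    have e01 : x 0 * N 1 = x 1 * N 0 := by rw [h0, h1]; linear_combination a 2 * hbx - b 2 * hax
    have e12 : x 1 * N 2 = x 2 * N 1 := by rw [h1, h2]; linear_combination a 0 * hbx - b 0 * hax
    have e20 : x 2 * N 0 = x 0 * N 2 := by rw [h0, h2]; linear_combination a 1 * hbx - b 1 * hax
    simp [Fin.forall_fin_succ, e01, e12, e20]
  have hN : ∃ m, N m ≠ 0 := by
    by_contra hcon
    push Not at hcon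
    have e0 := h0.symm.trans (hcon 0)
    have e1 := h1.symm.trans (hcon 1)
    have e2 := h2.symm.trans (hcon 2)
    have hall : ∀ k l, a k * b l = a l * b k := by
      rw [sub_eq_zero] at e0 e1 e2
      simp [Fin.forall_fin_succ, e0, e1, e2]
    obtain ⟨k, l, hkl⟩ := hab
    exact hkl (hall k l)
  obtain ⟨m, hm⟩ := hN
  have hc := key c hac hbc
  have hd := key d had hbd
  rw [← sub_eq_zero]
  refine (mul_eq_zero.1 ?_).resolve_left (pow_ne_zero 2 hm)
  linear_combination d j * N m * hc i m + c m * N i * hd j m - d i * N m * hc j m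
    - c m * N j * hd i m

theorem orthogonal_of_proportional {a c d : Fin 3 → R} (hcd : ∀ i j, c i * d j = c j * d i)
    (hc : ∃ i, c i ≠ 0) (hac : ∑ i, a i * c i = 0) : ∑ i, a i * d i = 0 := by
  obtain ⟨i, hi⟩ := hc
  refine (mul_eq_zero.1 ?_).resolve_left hi
  calc c i * ∑ j, a j * d j = d i * ∑ j, a j * c j := by
        rw [Finset.mul_sum, Finset.mul_sum]
        exact Finset.sum_congr rfl fun j _ => by linear_combination a j * hcd i j
    _ = 0 := by rw [hac, mul_zero]

end Proportional

/-! ### Substitution and the chain rule -/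

section PushHom

variable {ι κ : Type*}

/-- The ring homomorphism sending the unknown `a` to the commutative image of `g a`. -/
noncomputable def pushHom (g : FreeMonoid ι →* FreeMonoid κ) :
    MvPolynomial ι ℤ →+* MvPolynomial κ ℤ :=
  eval₂Hom C fun a => FreeMonoid.lift X (g (FreeMonoid.of a))

theorem pushHom_X (g : FreeMonoid ι →* FreeMonoid κ) (a : ι) :
    pushHom g (X a) = FreeMonoid.lift X (g (FreeMonoid.of a)) := by
  simp [pushHom]

theorem pushHom_fox [DecidableEq ι] (g : FreeMonoid ι →* FreeMonoid κ) (a : ι)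
    (w : FreeMonoid ι) :
    pushHom g (fox a w) =
      foxSum (fun i => FreeMonoid.lift X (g (FreeMonoid.of i))) (Pi.single a 1) w := by
  rw [fox, map_foxSum]
  congr 1
  · funext i; exact pushHom_X g i
  · funext i
    rw [Pi.single_apply, Pi.single_apply]
    split_ifs <;> simp

/-- The chain rule of the Fox calculus: it turns the word identity `g u = g v` into linear equations
for the Fox polynomials of `u` and `v`. -/
theorem fox_apply_hom [Fintype ι] [DecidableEq ι] [DecidableEq κ]
    (g : FreeMonoid ι →* FreeMonoid κ) (b : κ) (w : FreeMonoid ι) :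
    fox b (g w) = ∑ a, fox b (g (FreeMonoid.of a)) * pushHom g (fox a w) := by
  rw [fox, foxSum_apply_hom, foxSum_eq_sum]
  exact Finset.sum_congr rfl fun a _ => by rw [pushHom_fox]; rfl

theorem lift_X_ne_zero (w : FreeMonoid κ) :
    FreeMonoid.lift (X : κ → MvPolynomial κ ℤ) w ≠ 0 := by
  induction w using FreeMonoid.inductionOn' with
  | one => simp
  | of_mul i u ih =>
    rw [map_mul, FreeMonoid.lift_eval_of]
    exact mul_ne_zero (X_ne_zero i) ih

theorem constantCoeff_lift_X (w : FreeMonoid κ) :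
    constantCoeff (FreeMonoid.lift (X : κ → MvPolynomial κ ℤ) w) = 1 ∧ w = 1 ∨
      constantCoeff (FreeMonoid.lift (X : κ → MvPolynomial κ ℤ) w) = 0 ∧ w ≠ 1 := by
  induction w using FreeMonoid.casesOn with
  | one => simp
  | of_mul i u =>
    right
    refine ⟨by simp, ?_⟩
    exact of_mul_ne_one i u

theorem constantCoeff_pushHom_fox [DecidableEq ι] (g : FreeMonoid ι →* FreeMonoid κ) (a : ι)
    (w : FreeMonoid ι) :
    constantCoeff (pushHom g (fox a w)) =
      foxSum (fun i => constantCoeff (FreeMonoid.lift X (g (FreeMonoid.of i)))) (Pi.single a 1)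
        w := by
  rw [pushHom_fox, map_foxSum]
  congr 1
  funext i
  rw [Pi.single_apply, Pi.single_apply]
  split_ifs <;> simp

theorem constantCoeff_pushHom_fox_nonneg [DecidableEq ι] (g : FreeMonoid ι →* FreeMonoid κ)
    (a : ι) (w : FreeMonoid ι) : 0 ≤ constantCoeff (pushHom g (fox a w)) := by
  rw [constantCoeff_pushHom_fox]
  refine foxSum_nonneg (fun i => ?_) (fun i => ?_) w
  · rcases constantCoeff_lift_X (g (FreeMonoid.of i)) with h | h <;> simp [h.1]
  · rw [Pi.single_apply]
    split_ifs <;> norm_num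

theorem constantCoeff_pushHom_fox_of_mul_self [DecidableEq ι] (g : FreeMonoid ι →* FreeMonoid κ)
    (a : ι) (w : FreeMonoid ι) :
    0 < constantCoeff (pushHom g (fox a (FreeMonoid.of a * w))) := by
  rw [fox_of_mul, Pi.single_eq_same, map_add, map_one, map_add, map_one, map_mul, map_mul,
    pushHom_X]
  have h1 := constantCoeff_pushHom_fox_nonneg g a w
  rcases constantCoeff_lift_X (g (FreeMonoid.of a)) with h | h <;> rw [h.1] <;> linarith

theorem constantCoeff_pushHom_fox_of_mul_ne [DecidableEq ι] (g : FreeMonoid ι →* FreeMonoid κ)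
    {a i : ι} (hia : i ≠ a) (hi : g (FreeMonoid.of i) ≠ 1) (w : FreeMonoid ι) :
    constantCoeff (pushHom g (fox a (FreeMonoid.of i * w))) = 0 := by
  rw [fox_of_mul, Pi.single_eq_of_ne hia, zero_add, map_mul, map_mul, pushHom_X,
    ((constantCoeff_lift_X (g (FreeMonoid.of i))).resolve_left fun h => hi h.2).1, zero_mul]

end PushHom

/-! ### Solutions of rank two and vanishing minors -/

theorem HasRankTwo.eq_of_apply_eq_one {g : FreeMonoid (Fin 3) →* FreeMonoid Bool}
    (hg : HasRankTwo g) {i j : Fin 3} (hi : g (FreeMonoid.of i) = 1)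
    (hj : g (FreeMonoid.of j) = 1) : i = j := by
  by_contra hij
  obtain ⟨k, l, hkl⟩ := hg
  have key : ∀ x, g (FreeMonoid.of x) = 1 → k ≠ x ∧ l ≠ x := by
    intro x hx
    constructor <;> rintro rfl <;> simp [hx, letterCount_one] at hkl
  have hkl' : k ≠ l := by
    rintro rfl
    exact hkl rfl
  have := key i hi
  have := key j hj
  omega

/-- Common first letters cancel. If the first letters differ, rank two lets `g` erase at most one of
them. The constant coefficient at the letter opposite a nonerased one is then positive on one side
and zero on the other. -/
theorem HasRankTwo.exists_pushHom_fox_ne {g : FreeMonoid (Fin 3) →* FreeMonoid Bool}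
    (hg : HasRankTwo g) {u v : FreeMonoid (Fin 3)} (huv : u ≠ v) :
    ∃ a, pushHom g (fox a u - fox a v) ≠ 0 := by
  by_contra hcon
  push Not at hcon
  simp only [map_sub, sub_eq_zero] at hcon
  apply huv
  clear huv
  induction u using FreeMonoid.inductionOn' generalizing v with
  | one =>
    induction v using FreeMonoid.casesOn with
    | one => rfl
    | of_mul j v =>
      have h1 := constantCoeff_pushHom_fox_of_mul_self g j v
      rw [← hcon j] at h1
      simp [fox_one] at h1
  | of_mul i u ih =>
    induction v using FreeMonoid.casesOn with
    | one =>
      have h1 := constantCoeff_pushHom_fox_of_mul_self g i u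
      rw [hcon i] at h1
      simp [fox_one] at h1
    | of_mul j v =>
      by_cases hij : i = j
      · subst hij
        rw [ih fun a => ?_]
        have := hcon a
        rw [fox_of_mul, fox_of_mul, map_add, map_add, map_mul, map_mul, pushHom_X] at this
        exact mul_left_cancel₀ (lift_X_ne_zero _) (add_left_cancel this)
      · exfalso
        by_cases hj : g (FreeMonoid.of j) = 1
        · have hi : g (FreeMonoid.of i) ≠ 1 := fun hi => hij (hg.eq_of_apply_eq_one hi hj)
          have h1 := constantCoeff_pushHom_fox_of_mul_self g j v
          rw [← hcon j, constantCoeff_pushHom_fox_of_mul_ne g hij hi] at h1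
          exact lt_irrefl _ h1
        · have h1 := constantCoeff_pushHom_fox_of_mul_self g i u
          rw [hcon i, constantCoeff_pushHom_fox_of_mul_ne g (Ne.symm hij) hj] at h1
          exact lt_irrefl _ h1

/-- Setting all variables to one turns Fox polynomials into letter counts. -/
theorem HasRankTwo.fox_independent {g : FreeMonoid (Fin 3) →* FreeMonoid Bool}
    (hg : HasRankTwo g) : ∃ i j, fox true (g (FreeMonoid.of i)) * fox false (g (FreeMonoid.of j)) ≠
      fox true (g (FreeMonoid.of j)) * fox false (g (FreeMonoid.of i)) := by
  obtain ⟨i, j, hij⟩ := hg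
  refine ⟨i, j, fun h => hij ?_⟩
  have := congrArg (eval fun _ => (1 : ℤ)) h
  simp only [map_mul, eval_one_fox] at this
  exact_mod_cast this

/-- The difference of the Fox polynomials of the two sides of an equation. -/
noncomputable def foxDiff {n : ℕ} (E : WordEquation n) (a : Fin n) : MvPolynomial (Fin n) ℤ :=
  fox a E.lhs - fox a E.rhs

/-- The two by two minors of the matrix of the Fox polynomials of two equations. -/
noncomputable def minor {n : ℕ} (E F : WordEquation n) (k l : Fin n) : MvPolynomial (Fin n) ℤ :=
  E.foxDiff k * F.foxDiff l - E.foxDiff l * F.foxDiff k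

theorem isSolution_iff_foxDiff {n : ℕ} {κ : Type*} [DecidableEq κ] (E : WordEquation n)
    (g : FreeMonoid (Fin n) →* FreeMonoid κ) :
    E.IsSolution g ↔ ∀ b, ∑ a, fox b (g (FreeMonoid.of a)) * pushHom g (E.foxDiff a) = 0 := by
  have key : ∀ b, ∑ a, fox b (g (FreeMonoid.of a)) * pushHom g (E.foxDiff a) =
      fox b (g E.lhs) - fox b (g E.rhs) := by
    intro b
    rw [fox_apply_hom g b E.lhs, fox_apply_hom g b E.rhs, ← Finset.sum_sub_distrib]
    exact Finset.sum_congr rfl fun a _ => by rw [foxDiff, map_sub, mul_sub]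
  simp only [key, sub_eq_zero]
  exact ⟨fun h b => by rw [h], eq_of_fox_eq⟩

/-- Two equations with a common solution of rank two are dependent in the sense that the minors
of their Fox polynomials vanish at that solution, and conversely. -/
theorem HasRankTwo.isSolution_iff_minor {g : FreeMonoid (Fin 3) →* FreeMonoid Bool}
    (hg : HasRankTwo g) {E : WordEquation 3} (hE : E.lhs ≠ E.rhs) (hs : E.IsSolution g)
    (F : WordEquation 3) : F.IsSolution g ↔ ∀ k l, pushHom g (E.minor F k l) = 0 := by
  rw [isSolution_iff_foxDiff] at hs
  rw [isSolution_iff_foxDiff]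
  simp only [minor, map_sub, map_mul, sub_eq_zero]
  constructor
  · intro h
    exact proportional_of_orthogonal hg.fox_independent (hs true) (hs false) (h true) (h false)
  · intro h b
    refine orthogonal_of_proportional (fun k l => h k l) (hg.exists_pushHom_fox_ne hE) (hs b)

/-! ### Exponents of Fox polynomials -/

section Content

variable {ι κ : Type*}

/-- The vector of the numbers of occurrences of the letters in a word. -/
noncomputable def content (w : FreeMonoid ι) : ι →₀ ℕ :=
  (w.toList.map fun i => Finsupp.single i 1).sum

theorem content_one : content (1 : FreeMonoid ι) = 0 := rfl

theorem content_mul (u v : FreeMonoid ι) : content (u * v) = content u + content v := by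
  simp [content]

theorem content_of (i : ι) : content (FreeMonoid.of i) = Finsupp.single i 1 := by
  simp [content]

theorem content_apply [DecidableEq ι] (b : ι) (w : FreeMonoid ι) :
    content w b = letterCount b w := by
  induction w using FreeMonoid.inductionOn' with
  | one => simp [content_one, letterCount_one]
  | of_mul i u ih =>
    rw [content_mul, letterCount_mul, Finsupp.add_apply, ih, content_of, letterCount_of,
      Finsupp.single_apply]

theorem lift_X_eq_monomial (w : FreeMonoid ι) :
    FreeMonoid.lift (X : ι → MvPolynomial ι ℤ) w = monomial (content w) 1 := by
  induction w using FreeMonoid.inductionOn' with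
  | one => simp [content_one]
  | of_mul i u ih =>
    rw [map_mul, ih, FreeMonoid.lift_eval_of, content_mul, content_of, X, monomial_mul, one_mul]

variable [DecidableEq ι]

theorem exists_of_mem_support_fox {a : ι} {w : FreeMonoid ι} {m : ι →₀ ℕ}
    (hm : m ∈ (fox a w).support) : ∃ t r, w = t * (FreeMonoid.of a * r) ∧ m = content t := by
  induction w using FreeMonoid.inductionOn' generalizing m with
  | one => simp [fox_one] at hm
  | of_mul i u ih =>
    rw [fox_of_mul] at hm
    rcases Finset.mem_union.1 (support_add hm) with h | h
    · rw [Pi.single_apply] at h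
      split_ifs at h with hia
      · subst hia
        refine ⟨1, u, by simp, ?_⟩
        rw [content_one]
        by_contra hne
        rw [mem_support_iff, coeff_one, if_neg (Ne.symm hne)] at h
        exact h rfl
      · simp at h
    · rw [support_X_mul, Finset.mem_map] at h
      obtain ⟨m', hm', rfl⟩ := h
      obtain ⟨t, r, rfl, rfl⟩ := ih hm'
      exact ⟨FreeMonoid.of i * t, r, by rw [mul_assoc], by
        rw [content_mul, content_of]; rfl⟩

theorem coeff_fox_nonneg (a : ι) (w : FreeMonoid ι) (m : ι →₀ ℕ) : 0 ≤ coeff m (fox a w) := by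
  induction w using FreeMonoid.inductionOn' generalizing m with
  | one => simp [fox_one]
  | of_mul i u ih =>
    rw [fox_of_mul, coeff_add, coeff_X_mul', Pi.single_apply]
    refine add_nonneg ?_ ?_
    · split_ifs
      · rw [coeff_one]; split_ifs <;> norm_num
      · simp
    · split_ifs
      · exact ih _
      · exact le_rfl

theorem coeff_mul_nonneg {p q : MvPolynomial ι ℤ} (hp : ∀ m, 0 ≤ coeff m p)
    (hq : ∀ m, 0 ≤ coeff m q) (m : ι →₀ ℕ) : 0 ≤ coeff m (p * q) := by
  rw [coeff_mul]
  exact Finset.sum_nonneg fun x _ => mul_nonneg (hp _) (hq _)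

end Content

/-! ### Counting antichains of exponents -/

section Antichain

variable {ι : Type*}

theorem eq_or_le_of_mul_eq_mul {s r s' r' : FreeMonoid ι} (h : s * r = s' * r') :
    content s ≤ content s' ∨ content s' ≤ content s := by
  rcases List.append_eq_append_iff.1 (show s.toList ++ r.toList = s'.toList ++ r'.toList from h)
    with ⟨c, hc, -⟩ | ⟨c, hc, -⟩
  · left
    rw [show s' = s * FreeMonoid.ofList c from hc, content_mul]
    exact le_self_add
  · right
    rw [show s = s' * FreeMonoid.ofList c from hc, content_mul]
    exact le_self_add

theorem length_eq_of_mul_eq_mul {t r t' r' : FreeMonoid ι} {a a' : ι}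
    (h : t * (FreeMonoid.of a * r) = t' * (FreeMonoid.of a' * r'))
    (hl : t.length = t'.length) : t = t' ∧ a = a' := by
  obtain ⟨h1, h2⟩ := List.append_inj
    (show t.toList ++ (a :: r.toList) = t'.toList ++ (a' :: r'.toList) from h) hl
  exact ⟨h1, (List.cons.inj h2).1⟩

/-- An antichain of exponents of products of Fox polynomials, in which the second word depends
only on the first word and the letter, has at most as many elements as the first words have
letters. -/
theorem card_le_of_isAntichain [DecidableEq ι] (U : Bool → FreeMonoid ι) (Y : Bool → ι → FreeMonoid ι)
    (A : Finset (ι →₀ ℕ)) (hA : IsAntichain (· ≤ ·) (A : Set (ι →₀ ℕ)))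
    (h : ∀ m ∈ A, ∃ b a c, m ∈ (fox a (U b) * fox c (Y b a)).support) :
    A.card ≤ (U true).length + (U false).length := by
  classical
  -- Each exponent is charged to a position in one of the first words.
  let r : (ι →₀ ℕ) → (Σ _ : Bool, ℕ) → Prop := fun m x =>
    ∃ t a r s r', U x.1 = t * (FreeMonoid.of a * r) ∧ t.length = x.2 ∧
      Y x.1 a = s * r' ∧ m = content t + content s
  have hcard := Finset.card_le_card_of_forall_subsingleton r (s := A)
    (t := Finset.univ.sigma fun b => Finset.range (U b).length) ?_ ?_
  · rw [Finset.card_sigma] at hcard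
    simpa using hcard
  · intro m hm
    obtain ⟨b, a, c, hmul⟩ := h m hm
    obtain ⟨p, hp, q, hq, rfl⟩ := Finset.mem_add.1 (support_mul _ _ hmul)
    obtain ⟨t, r, ht, rfl⟩ := exists_of_mem_support_fox hp
    obtain ⟨s, r', hs, rfl⟩ := exists_of_mem_support_fox hq
    refine ⟨⟨b, t.length⟩, ?_, t, a, r, s, _, ht, rfl, hs, rfl⟩
    simp only [Finset.mem_sigma, Finset.mem_univ, Finset.mem_range, true_and]
    rw [ht]
    simp only [FreeMonoid.length_mul, FreeMonoid.length_of]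
    omega
  · rintro ⟨b, n⟩ -
    rintro m ⟨hm, t, a, r, s, z, hU, hl, hY, rfl⟩ m' ⟨hm', t', a', r', s', z', hU', hl', hY', rfl⟩
    obtain ⟨rfl, rfl⟩ := length_eq_of_mul_eq_mul (hU.symm.trans hU') (hl.trans hl'.symm)
    -- The position fixes the letter, hence the second word. Prefixes of one word have comparable
    -- contents, so the antichain has only one exponent per position.
    rcases eq_or_le_of_mul_eq_mul (hY.symm.trans hY') with h | h
    · exact hA.eq hm hm' (add_le_add_right h _)
    · exact (hA.eq hm' hm (add_le_add_right h _)).symm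

end Antichain

/-! ### Minimal exponents of a minor -/

section Minor

/-- The equation with its two sides exchanged. -/
def swap {n : ℕ} (E : WordEquation n) : WordEquation n := ⟨E.rhs, E.lhs⟩

theorem minor_swap {n : ℕ} (E F : WordEquation n) (k l : Fin n) :
    E.minor F.swap k l = -E.minor F k l := by
  simp only [minor, foxDiff, swap]
  ring

/-- A minor expands into eight products of Fox polynomials, which have nonnegative coefficients. A
positive coefficient must come from one of the four products with a plus sign, and in these the side
of `E` and the letter differentiated there determine the side of `F`. -/
theorem card_le_length_of_isAntichain {n : ℕ} (E F : WordEquation n) (k l : Fin n)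
    (A : Finset (Fin n →₀ ℕ)) (hA : IsAntichain (· ≤ ·) (A : Set (Fin n →₀ ℕ)))
    (h : ∀ m ∈ A, 0 < coeff m (E.minor F k l)) : A.card ≤ E.length := by
  by_cases hkl : k = l
  · subst hkl
    have : A = ∅ := by
      refine Finset.eq_empty_of_forall_notMem fun m hm => ?_
      have := h m hm
      simp [minor] at this
    simp [this]
  have hlen : E.length = E.lhs.length + E.rhs.length := by
    simp [length, FreeMonoid.length_mul]
  rw [hlen]
  refine card_le_of_isAntichain (fun b => cond b E.lhs E.rhs)
    (fun b a => if a = k then cond b F.lhs F.rhs else cond b F.rhs F.lhs) A hA ?_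
  intro m hm
  by_contra hcon
  push Not at hcon
  have z1 := hcon true k l
  have z2 := hcon false k l
  have z3 := hcon true l k
  have z4 := hcon false l k
  simp only [cond_true, cond_false, if_true, if_neg (Ne.symm hkl), mem_support_iff, not_not]
    at z1 z2 z3 z4
  have hpos := h m hm
  have nn : ∀ a b u v, 0 ≤ coeff m (fox a u * fox b v : MvPolynomial (Fin n) ℤ) :=
    fun a b u v => coeff_mul_nonneg (coeff_fox_nonneg a u) (coeff_fox_nonneg b v) m
  have e : E.minor F k l = (fox k E.lhs * fox l F.lhs + fox k E.rhs * fox l F.rhs +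
      fox l E.lhs * fox k F.rhs + fox l E.rhs * fox k F.lhs) - (fox k E.lhs * fox l F.rhs +
      fox k E.rhs * fox l F.lhs + fox l E.lhs * fox k F.lhs + fox l E.rhs * fox k F.rhs) := by
    simp only [minor, foxDiff]
    ring
  rw [e] at hpos
  simp only [coeff_sub, coeff_add, z1, z2, z3, z4] at hpos
  have := nn k l E.lhs F.rhs
  have := nn k l E.rhs F.lhs
  have := nn l k E.lhs F.lhs
  have := nn l k E.rhs F.rhs
  linarith

open Classical in
/-- The minimal exponents with a positive coefficient. -/
noncomputable def minPos {ι : Type*} (M : MvPolynomial ι ℤ) : Finset (ι →₀ ℕ) :=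
  M.support.filter fun m => Minimal (fun m => 0 < coeff m M) m

theorem mem_minPos {ι : Type*} {M : MvPolynomial ι ℤ} {m : ι →₀ ℕ} :
    m ∈ minPos M ↔ Minimal (fun m => 0 < coeff m M) m := by
  classical
  rw [minPos, Finset.mem_filter, and_iff_right_iff_imp]
  exact fun h => mem_support_iff.2 h.prop.ne'

theorem card_minPos_minor_le {n : ℕ} (E F : WordEquation n) (k l : Fin n) :
    (minPos (E.minor F k l)).card ≤ E.length := by
  refine E.card_le_length_of_isAntichain F k l _ ?_ fun m hm => (mem_minPos.1 hm).prop
  intro x hx y hy hxy hle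
  exact hxy ((mem_minPos.1 hy).eq_of_le (mem_minPos.1 hx).prop hle)

end Minor

/-! ### Collisions of exponents under substitution -/

section Push

variable {ι κ : Type*} [Fintype ι]

/-- The effect of `pushHom` on exponents. -/
noncomputable def push (g : FreeMonoid ι →* FreeMonoid κ) (m : ι →₀ ℕ) : κ →₀ ℕ :=
  ∑ a, m a • content (g (FreeMonoid.of a))

theorem push_mono (g : FreeMonoid ι →* FreeMonoid κ) : Monotone (push g) := by
  intro m m' h
  exact Finset.sum_le_sum fun a _ => nsmul_le_nsmul_left (by simp) (h a)

theorem push_apply [DecidableEq κ] (g : FreeMonoid ι →* FreeMonoid κ) (m : ι →₀ ℕ) (b : κ) :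
    push g m b = ∑ a, m a * letterCount b (g (FreeMonoid.of a)) := by
  simp [push, Finsupp.finsetSum_apply, content_apply]

theorem pushHom_monomial (g : FreeMonoid ι →* FreeMonoid κ) (m : ι →₀ ℕ) (c : ℤ) :
    pushHom g (monomial m c) = monomial (push g m) c := by
  rw [pushHom, eval₂Hom_monomial, Finsupp.prod_fintype _ _ fun _ => pow_zero _]
  simp only [lift_X_eq_monomial, monomial_pow, one_pow]
  rw [← monomial_sum_one, C_mul_monomial, mul_one, push]

theorem coeff_pushHom [DecidableEq κ] (g : FreeMonoid ι →* FreeMonoid κ) (M : MvPolynomial ι ℤ)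
    (k : κ →₀ ℕ) :
    coeff k (pushHom g M) = ∑ m ∈ M.support with push g m = k, coeff m M := by
  conv_lhs => rw [M.as_sum]
  rw [map_sum, coeff_sum, Finset.sum_filter]
  exact Finset.sum_congr rfl fun m _ => by rw [pushHom_monomial, coeff_monomial]

/-- The coefficients of `pushHom g M` are sums over the fibres of `push g`, so their vanishing
depends only on the partition into fibres. -/
theorem pushHom_eq_zero_of_push_eq [DecidableEq κ] {g g' : FreeMonoid ι →* FreeMonoid κ}
    (h : ∀ p q, push g p = push g q ↔ push g' p = push g' q) {M : MvPolynomial ι ℤ}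
    (hM : pushHom g M = 0) : pushHom g' M = 0 := by
  ext k
  rw [coeff_zero, coeff_pushHom]
  by_cases hk : ∃ m, push g' m = k
  · obtain ⟨m, rfl⟩ := hk
    have := coeff_pushHom g M (push g m)
    rw [hM, coeff_zero] at this
    rw [this]
    exact Finset.sum_congr (Finset.filter_congr fun x _ => (h x m).symm) fun _ _ => rfl
  · push Not at hk
    rw [Finset.filter_false_of_mem fun m _ => hk m, Finset.sum_empty]

/-- If `pushHom g` annihilates a nonzero polynomial, then some minimal exponents of opposite
signs have the same image. -/
theorem exists_push_eq [DecidableEq κ] {g : FreeMonoid ι →* FreeMonoid κ}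
    {M : MvPolynomial ι ℤ} (hM : M ≠ 0) (h : pushHom g M = 0) :
    ∃ p ∈ minPos M, ∃ q ∈ minPos (-M), push g p = push g q := by
  obtain ⟨m1, hm1⟩ := support_nonempty.2 hM
  obtain ⟨k, -, hk⟩ := exists_minimal_le_of_wellFoundedLT
    (fun k => ∃ m ∈ M.support, push g m = k) (push g m1) ⟨m1, hm1, rfl⟩
  obtain ⟨m, hm, hmk⟩ := hk.prop
  have hsum := coeff_pushHom g M k
  rw [h, coeff_zero] at hsum
  have hmem : m ∈ M.support.filter fun m => push g m = k := Finset.mem_filter.2 ⟨hm, hmk⟩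
  have hne : coeff m M ≠ 0 := mem_support_iff.1 hm
  obtain ⟨x, hx, hxp⟩ := Finset.exists_pos_of_sum_zero_of_exists_nonzero _ hsum.symm
    ⟨m, hmem, hne⟩
  obtain ⟨y, hy, hyp⟩ := Finset.exists_pos_of_sum_zero_of_exists_nonzero (fun m => -coeff m M)
    (by rw [Finset.sum_neg_distrib, ← hsum, neg_zero]) ⟨m, hmem, neg_ne_zero.2 hne⟩
  -- Replacing `x` and `y` by minimal exponents below them cannot lower the image, since `k` is
  -- minimal among images of the support.
  obtain ⟨p, hpx, hp⟩ := exists_minimal_le_of_wellFoundedLT (fun m => 0 < coeff m M) x hxp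
  obtain ⟨q, hqy, hq⟩ := exists_minimal_le_of_wellFoundedLT (fun m => 0 < coeff m (-M)) y
    (by rwa [coeff_neg])
  have hpk : push g p = k := hk.eq_of_le ⟨p, mem_support_iff.2 hp.prop.ne', rfl⟩
    ((push_mono g hpx).trans_eq (Finset.mem_filter.1 hx).2)
  have hqk : push g q = k := hk.eq_of_le
    ⟨q, by simpa [coeff_neg] using hq.prop.ne', rfl⟩
    ((push_mono g hqy).trans_eq (Finset.mem_filter.1 hy).2)
  exact ⟨p, mem_minPos.2 hp, q, mem_minPos.2 hq, hpk.trans hqk.symm⟩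

end Push

/-! ### Classes of solutions of rank two -/

section Classes

theorem push_eq_push_iff {n : ℕ} {κ : Type*} [DecidableEq κ]
    (g : FreeMonoid (Fin n) →* FreeMonoid κ) (p q : Fin n →₀ ℕ) :
    push g p = push g q ↔
      ∀ b, ∑ a, (letterCount b (g (FreeMonoid.of a)) : ℤ) * ((p a : ℤ) - q a) = 0 := by
  rw [Finsupp.ext_iff]
  refine forall_congr' fun b => ?_
  rw [push_apply, push_apply, ← Nat.cast_inj (R := ℤ), ← sub_eq_zero]
  push_cast
  rw [← Finset.sum_sub_distrib]
  refine Eq.congr (Finset.sum_congr rfl fun a _ => ?_) rfl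
  ring

/-- The kernel of the count matrix of `g` is a line spanned by `p - q`, and `p - q` also lies in the
kernel for `g'`. -/
theorem HasRankTwo.push_eq_of_push_eq {g g' : FreeMonoid (Fin 3) →* FreeMonoid Bool}
    (hg : HasRankTwo g) {p q : Fin 3 →₀ ℕ} (hpq : p ≠ q)
    (h : push g p = push g q) (h' : push g' p = push g' q) {x y : Fin 3 →₀ ℕ}
    (hxy : push g x = push g y) : push g' x = push g' y := by
  rw [push_eq_push_iff] at h h' hxy ⊢
  obtain ⟨i, j, hij⟩ := hg
  have hprop := proportional_of_orthogonal (R := ℤ) ⟨i, j, by exact_mod_cast hij⟩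
    (h true) (h false) (hxy true) (hxy false)
  intro b
  refine orthogonal_of_proportional hprop ?_ (h' b)
  obtain ⟨a, ha⟩ := DFunLike.ne_iff.1 hpq
  exact ⟨a, by rwa [Ne, sub_eq_zero, Nat.cast_inj]⟩

theorem HasRankTwo.isSolution_iff_of_push_eq {g g' : FreeMonoid (Fin 3) →* FreeMonoid Bool}
    (hg : HasRankTwo g) (hg' : HasRankTwo g') {p q : Fin 3 →₀ ℕ} (hpq : p ≠ q)
    (h : push g p = push g q) (h' : push g' p = push g' q) {E : WordEquation 3}
    (hE : E.lhs ≠ E.rhs) (hs : E.IsSolution g) (hs' : E.IsSolution g') (F : WordEquation 3) :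
    F.IsSolution g ↔ F.IsSolution g' := by
  rw [hg.isSolution_iff_minor hE hs, hg'.isSolution_iff_minor hE hs']
  have key : ∀ x y, push g x = push g y ↔ push g' x = push g' y := fun x y =>
    ⟨hg.push_eq_of_push_eq hpq h h', hg'.push_eq_of_push_eq hpq h' h⟩
  exact ⟨fun H k l => pushHom_eq_zero_of_push_eq key (H k l),
    fun H k l => pushHom_eq_zero_of_push_eq (fun x y => (key x y).symm) (H k l)⟩

/-- Two equations, the second of which is not a consequence of the first for solutions of rank
two, have a bounded number of essentially different common solutions of rank two. -/
theorem card_le_length_sq {ι : Type*} {E F : WordEquation 3} (hE : E.lhs ≠ E.rhs)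
    {g₀ : FreeMonoid (Fin 3) →* FreeMonoid Bool} (hg₀ : HasRankTwo g₀) (hs₀ : E.IsSolution g₀)
    (hn₀ : ¬ F.IsSolution g₀) (I : Finset ι) (g : ι → FreeMonoid (Fin 3) →* FreeMonoid Bool)
    (hg : ∀ i ∈ I, HasRankTwo (g i)) (hsE : ∀ i ∈ I, E.IsSolution (g i))
    (hsF : ∀ i ∈ I, F.IsSolution (g i))
    (hsep : ∀ i ∈ I, ∀ j ∈ I,
      (∀ G : WordEquation 3, G.IsSolution (g i) ↔ G.IsSolution (g j)) → i = j) :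
    I.card ≤ E.length ^ 2 := by
  rw [hg₀.isSolution_iff_minor hE hs₀] at hn₀
  push Not at hn₀
  obtain ⟨k, l, hkl⟩ := hn₀
  have hM : E.minor F k l ≠ 0 := fun h => hkl (by rw [h, map_zero])
  -- Each solution is charged to a colliding pair of minimal exponents of opposite signs; such a
  -- pair determines its class.
  have hcard := Finset.card_le_card_of_forall_subsingleton
    (fun i (x : (Fin 3 →₀ ℕ) × (Fin 3 →₀ ℕ)) => push (g i) x.1 = push (g i) x.2)
    (s := I) (t := minPos (E.minor F k l) ×ˢ minPos (-E.minor F k l)) ?_ ?_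
  · rw [Finset.card_product, ← minor_swap] at hcard
    rw [sq]
    exact hcard.trans (Nat.mul_le_mul (card_minPos_minor_le E F k l)
      (card_minPos_minor_le E F.swap k l))
  · intro i hi
    obtain ⟨p, hp, q, hq, h⟩ := exists_push_eq hM
      (((hg i hi).isSolution_iff_minor hE (hsE i hi) F).1 (hsF i hi) k l)
    exact ⟨(p, q), Finset.mk_mem_product hp hq, h⟩
  · rintro ⟨p, q⟩ hpq i ⟨hi, h⟩ j ⟨hj, h'⟩
    obtain ⟨hp, hq⟩ := Finset.mem_product.1 hpq
    have hne : p ≠ q := by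
      rintro rfl
      have h1 := (mem_minPos.1 hp).prop
      have h2 := (mem_minPos.1 hq).prop
      rw [coeff_neg] at h2
      linarith
    exact hsep i hi j hj fun G => (hg i hi).isSolution_iff_of_push_eq (hg j hj) hne h h' hE
      (hsE i hi) (hsE j hj) G

end Classes

/-! ### Periodic solutions -/

/-- The difference of the contents of the two sides of an equation. -/
noncomputable def contentDiff {n : ℕ} (E : WordEquation n) (a : Fin n) : ℤ :=
  (content E.lhs a : ℤ) - content E.rhs a

theorem content_apply_hom {ι κ : Type*} [Fintype ι] (g : FreeMonoid ι →* FreeMonoid κ)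
    (w : FreeMonoid ι) : content (g w) = push g (content w) := by
  classical
  induction w using FreeMonoid.inductionOn' with
  | one => simp [push, content_one]
  | of_mul i u ih =>
    rw [map_mul, content_mul, ih, content_mul, push, push, content_of]
    simp [add_smul, Finset.sum_add_distrib, Finsupp.single_apply, ite_smul]

theorem IsSolution.push_content_eq {n : ℕ} {κ : Type*} {E : WordEquation n}
    {g : FreeMonoid (Fin n) →* FreeMonoid κ} (h : E.IsSolution g) :
    push g (content E.lhs) = push g (content E.rhs) := by
  rw [← content_apply_hom, ← content_apply_hom, show g E.lhs = g E.rhs from h]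

theorem pow_eq_pow_iff_of_ne_one {κ : Type*} {w : FreeMonoid κ} (hw : w ≠ 1) {k l : ℕ} :
    w ^ k = w ^ l ↔ k = l := by
  refine ⟨fun h => ?_, fun h => by rw [h]⟩
  have hlen : ∀ k : ℕ, (w ^ k).length = k * w.length := by
    intro k
    induction k with
    | zero => simp
    | succ k ih => rw [pow_succ, FreeMonoid.length_mul, ih, Nat.succ_mul]
  have h2 := congrArg FreeMonoid.length h
  rw [hlen, hlen] at h2
  refine Nat.eq_of_mul_eq_mul_right (Nat.pos_of_ne_zero fun h0 => hw ?_) h2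
  exact FreeMonoid.length_eq_zero.1 h0

theorem apply_eq_pow_of_apply_of_eq_pow {n : ℕ} {κ : Type*} {w : FreeMonoid κ} {t : Fin n → ℕ}
    {h : FreeMonoid (Fin n) →* FreeMonoid κ} (ht : ∀ a, h (FreeMonoid.of a) = w ^ t a)
    (u : FreeMonoid (Fin n)) : h u = w ^ ∑ a, content u a * t a := by
  induction u using FreeMonoid.inductionOn' with
  | one => simp [content_one]
  | of_mul i u ih =>
    rw [map_mul, ih, ht, ← pow_add, content_mul, content_of]
    simp [add_mul, Finset.sum_add_distrib, Finsupp.single_apply]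

/-- The equations solved by a periodic morphism are those whose content difference is orthogonal
to a fixed vector. -/
theorem IsPeriodic.exists_isSolution_iff {n : ℕ} {κ : Type*}
    {h : FreeMonoid (Fin n) →* FreeMonoid κ} (hp : IsPeriodic h) :
    ∃ t : Fin n → ℤ, ∀ E : WordEquation n, E.IsSolution h ↔ ∑ a, t a * E.contentDiff a = 0 := by
  obtain ⟨w, hw⟩ := (isPeriodic_iff_isPowerMorphism h).1 hp
  choose t ht using hw
  by_cases hw1 : w = 1
  · refine ⟨0, fun E => ?_⟩
    simp [IsSolution, apply_eq_pow_of_apply_of_eq_pow ht, hw1]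
  · refine ⟨fun a => t a, fun E => ?_⟩
    rw [IsSolution, apply_eq_pow_of_apply_of_eq_pow ht, apply_eq_pow_of_apply_of_eq_pow ht,
      pow_eq_pow_iff_of_ne_one hw1, ← Nat.cast_inj (R := ℤ), ← sub_eq_zero]
    push_cast
    rw [← Finset.sum_sub_distrib]
    refine Eq.congr (Finset.sum_congr rfl fun a _ => ?_) rfl
    rw [contentDiff]
    ring

/-- The vectors `v i` are independent: pairing a relation with `t i`, for the last `i` with a
nonzero coefficient, leaves a single nonzero term. -/
theorem card_le_of_triangular {m n : ℕ} (I : Finset (Fin m)) (v t : Fin m → Fin n → ℤ)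
    (hd : ∀ i ∈ I, ∑ a, t i a * v i a ≠ 0)
    (hz : ∀ i ∈ I, ∀ j ∈ I, j < i → ∑ a, t i a * v j a = 0) : I.card ≤ n := by
  have hli : LinearIndependent ℤ fun i : I => v i := by
    rw [Fintype.linearIndependent_iff]
    intro c hc
    by_contra hcon
    push Not at hcon
    obtain ⟨i₀, hi₀⟩ := hcon
    obtain ⟨i, hi⟩ := (Finset.univ.filter fun i => c i ≠ 0).exists_maximal
      ⟨i₀, by simp [hi₀]⟩
    have hci : c i ≠ 0 := (Finset.mem_filter.1 hi.prop).2
    have hsum : ∑ j : I, c j * ∑ a, t i a * v j a = 0 := by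
      simp only [Finset.mul_sum]
      rw [Finset.sum_comm]
      refine Finset.sum_eq_zero fun a _ => ?_
      have := congrFun hc a
      rw [Finset.sum_apply] at this
      simp only [Pi.smul_apply, smul_eq_mul, Pi.zero_apply] at this
      rw [← mul_zero (t i a), ← this, Finset.mul_sum]
      exact Finset.sum_congr rfl fun j _ => by ring
    rw [Finset.sum_eq_single i] at hsum
    · exact (mul_ne_zero hci (hd i i.2)) hsum
    · intro j _ hji
      rcases lt_or_gt_of_ne hji with h | h
      · rw [hz i i.2 j j.2 h, mul_zero]
      · by_cases hcj : c j = 0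
        · rw [hcj, zero_mul]
        · exact absurd h (hi.not_gt (Finset.mem_filter.2 ⟨Finset.mem_univ _, hcj⟩))
    · simp
  have := hli.fintype_card_le_finrank
  simpa using this

/-! ### Bounds for chains and independent systems -/

theorem length_pos_of_ne {n : ℕ} {E : WordEquation n} (hE : E.lhs ≠ E.rhs) : 0 < E.length := by
  rw [length, FreeMonoid.length_mul]
  by_contra hcon
  apply hE
  rw [FreeMonoid.length_eq_zero.1 (by omega : E.lhs.length = 0),
    FreeMonoid.length_eq_zero.1 (by omega : E.rhs.length = 0)]

theorem ne_of_not_isSolution {n : ℕ} {κ : Type*} {E : WordEquation n}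
    {h : FreeMonoid (Fin n) →* FreeMonoid κ} (hn : ¬ E.IsSolution h) : E.lhs ≠ E.rhs :=
  fun he => hn (congrArg h he)

theorem IsChainOfEquations.le_length_sq_add {α : Type*} {m : ℕ} (hm : 0 < m)
    {E : Fin m → WordEquation 3} (hc : IsChainOfEquations α E) :
    m ≤ (E ⟨0, hm⟩).length ^ 2 + 5 := by
  classical
  choose h hn hs using hc
  have hE := ne_of_not_isSolution (hn ⟨0, hm⟩)
  have hP : (Finset.univ.filter fun i => IsPeriodic (h i)).card ≤ 3 := by
    have : ∀ i, ∃ t : Fin 3 → ℤ, IsPeriodic (h i) →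
        ∀ E : WordEquation 3, E.IsSolution (h i) ↔ ∑ a, t a * E.contentDiff a = 0 := by
      intro i
      by_cases hp : IsPeriodic (h i)
      · obtain ⟨t, ht⟩ := hp.exists_isSolution_iff
        exact ⟨t, fun _ => ht⟩
      · exact ⟨0, fun hp' => absurd hp' hp⟩
    choose t ht using this
    refine card_le_of_triangular _ (fun i => (E i).contentDiff) t (fun i hi => ?_)
      fun i hi j _ hji => ?_
    · rw [Ne, ← ht i (Finset.mem_filter.1 hi).2]
      exact hn i
    · rw [← ht i (Finset.mem_filter.1 hi).2]
      exact hs i j hji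
  have hN : (Finset.univ.filter fun i : Fin m => ⟨0, hm⟩ < i ∧ ¬ IsPeriodic (h i)).card ≤
      (E ⟨0, hm⟩).length ^ 2 + 1 := by
    set N := Finset.univ.filter fun i : Fin m => ⟨0, hm⟩ < i ∧ ¬ IsPeriodic (h i) with hNdef
    rcases N.eq_empty_or_nonempty with h0 | hne
    · rw [h0]; simp
    have hmem : ∀ i, i ∈ N → ⟨0, hm⟩ < i ∧ ¬ IsPeriodic (h i) := fun i hi =>
      (Finset.mem_filter.1 hi).2
    have : ∀ i, ∃ g, i ∈ N → HasRankTwo g ∧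
        ∀ F : WordEquation 3, F.IsSolution (h i) ↔ F.IsSolution g := by
      intro i
      by_cases hi : i ∈ N
      · obtain ⟨g, hg⟩ := exists_hasRankTwo (hmem i hi).2 hE (hs i _ (hmem i hi).1)
        exact ⟨g, fun _ => hg⟩
      · exact ⟨1, fun hi' => absurd hi' hi⟩
    choose g hg using this
    have hk := N.min'_mem hne
    -- `E k` plays the role of `F`: its own witness solves the first equation but not `E k`, while
    -- all later witnesses solve both.
    set k := N.min' hne
    have hlt : ∀ i ∈ N.erase k, k < i := fun i hi =>
      lt_of_le_of_ne (N.min'_le i (Finset.mem_of_mem_erase hi)) (Finset.ne_of_mem_erase hi).symm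
    have hsep : ∀ i ∈ N, ∀ j ∈ N, i < j →
        ¬ ∀ G : WordEquation 3, G.IsSolution (g i) ↔ G.IsSolution (g j) := fun i hi j hj hij H =>
      hn i (((hg i hi).2 _).2 ((H _).2 (((hg j hj).2 _).1 (hs j i hij))))
    have hcard := card_le_length_sq hE (hg k hk).1
      (((hg k hk).2 _).1 (hs k _ (hmem k hk).1)) (fun H => hn k (((hg k hk).2 _).2 H))
      (N.erase k) g (fun i hi => (hg i (Finset.mem_of_mem_erase hi)).1)
      (fun i hi => ((hg i (Finset.mem_of_mem_erase hi)).2 _).1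
        (hs i _ (hmem i (Finset.mem_of_mem_erase hi)).1))
      (fun i hi => ((hg i (Finset.mem_of_mem_erase hi)).2 _).1 (hs i k (hlt i hi)))
      (fun i hi j hj H => by
        have hi' := Finset.mem_of_mem_erase hi
        have hj' := Finset.mem_of_mem_erase hj
        rcases lt_trichotomy i j with h' | h' | h'
        · exact absurd H (hsep i hi' j hj' h')
        · exact h'
        · exact absurd (fun G => (H G).symm) (hsep j hj' i hi' h'))
    rw [Finset.card_erase_of_mem hk] at hcard
    omega
  -- The constant 5 is 1 for the first index, 3 for the periodic witnesses and 1 for the index `k`.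
  have hcover : (Finset.univ : Finset (Fin m)) ⊆ insert ⟨0, hm⟩
      ((Finset.univ.filter fun i => IsPeriodic (h i)) ∪
        Finset.univ.filter fun i : Fin m => ⟨0, hm⟩ < i ∧ ¬ IsPeriodic (h i)) := by
    intro i _
    simp only [Finset.mem_insert, Finset.mem_union, Finset.mem_filter, Finset.mem_univ, true_and,
      Fin.lt_def, Fin.ext_iff]
    by_cases hp : IsPeriodic (h i)
    · exact Or.inr (Or.inl hp)
    · rcases Nat.eq_zero_or_pos i with h0 | h0
      · exact Or.inl h0
      · exact Or.inr (Or.inr ⟨h0, hp⟩)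
  have h1 := Finset.card_le_card hcover
  have h2 := h1.trans (Finset.card_insert_le _ _)
  have h3 := Finset.card_union_le (Finset.univ.filter fun i => IsPeriodic (h i))
    (Finset.univ.filter fun i : Fin m => ⟨0, hm⟩ < i ∧ ¬ IsPeriodic (h i))
  rw [Finset.card_univ, Fintype.card_fin] at h2
  omega

theorem IsIndependentSystem.le_length_sq_add {α : Type*} {m : ℕ} (hm : 0 < m)
    {E : Fin m → WordEquation 3} (hc : IsIndependentSystem α E)
    {h₀ : FreeMonoid (Fin 3) →* FreeMonoid α} (hs₀ : ∀ i, (E i).IsSolution h₀)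
    (hp₀ : ¬ IsPeriodic h₀) : m ≤ (E ⟨0, hm⟩).length ^ 2 + 1 := by
  classical
  choose h hn hs using hc
  have hE := ne_of_not_isSolution (hn ⟨0, hm⟩)
  obtain ⟨g₀, hg₀, hgs₀⟩ := exists_hasRankTwo hp₀ hE (hs₀ _)
  replace hs₀ : ∀ i, (E i).IsSolution g₀ := fun i => (hgs₀ _).1 (hs₀ i)
  by_cases hper : ∃ i ≠ (⟨0, hm⟩ : Fin m), IsPeriodic (h i)
  · obtain ⟨i, hi0, hp⟩ := hper
    have hsub : (Finset.univ : Finset (Fin m)) ⊆ {⟨0, hm⟩, i} := by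
      intro j _
      rw [Finset.mem_insert, Finset.mem_singleton]
      by_contra hj
      push Not at hj
      obtain ⟨hj0, hji⟩ := hj
      obtain ⟨t, ht⟩ := hp.exists_isSolution_iff
      have hti := hn i
      rw [ht] at hti
      have hne : ∃ a, (E i).contentDiff a ≠ 0 := by
        by_contra hcon
        push Not at hcon
        simp [hcon] at hti
      by_cases hpj : IsPeriodic (h j)
      · obtain ⟨t', ht'⟩ := hpj.exists_isSolution_iff
        obtain ⟨x, y, hxy⟩ := hg₀
        have o := fun l => (push_eq_push_iff g₀ _ _).1 (hs₀ l).push_content_eq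
        have hprop := proportional_of_orthogonal (R := ℤ) ⟨x, y, by exact_mod_cast hxy⟩
          (o i true) (o i false) (o j true) (o j false)
        exact hn j ((ht' _).2 (orthogonal_of_proportional hprop hne
          ((ht' _).1 (hs j i (Ne.symm hji)))))
      · obtain ⟨g, hg, hgs⟩ := exists_hasRankTwo hpj hE (hs j _ (Ne.symm hj0))
        have hne' : content (E i).lhs ≠ content (E i).rhs := by
          intro heq
          obtain ⟨a, ha⟩ := hne
          exact ha (by rw [contentDiff, heq, sub_self])
        have hgi : (E i).IsSolution g := (hgs _).1 (hs j i (Ne.symm hji))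
        exact hn j ((hgs _).2 ((hg₀.isSolution_iff_of_push_eq hg hne' (hs₀ i).push_content_eq
          hgi.push_content_eq hE (hs₀ _) ((hgs _).1 (hs j _ (Ne.symm hj0))) _).1 (hs₀ j)))
    have h1 := (Finset.card_le_card hsub).trans Finset.card_le_two
    rw [Finset.card_univ, Fintype.card_fin] at h1
    have : 0 < (E ⟨0, hm⟩).length ^ 2 := pow_pos (length_pos_of_ne hE) 2
    omega
  · push Not at hper
    have : ∀ i, ∃ g, i ≠ (⟨0, hm⟩ : Fin m) → HasRankTwo g ∧
        ∀ F : WordEquation 3, F.IsSolution (h i) ↔ F.IsSolution g := by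
      intro i
      by_cases hi : i = ⟨0, hm⟩
      · exact ⟨1, fun hi' => absurd hi hi'⟩
      · obtain ⟨g, hg⟩ := exists_hasRankTwo (hper i hi) hE (hs i _ (Ne.symm hi))
        exact ⟨g, fun _ => hg⟩
    choose g hg using this
    have hsolve : ∀ i ≠ (⟨0, hm⟩ : Fin m), ∀ j ≠ i, (E j).IsSolution (g i) := fun i hi j hj =>
      ((hg i hi).2 _).1 (hs i j hj)
    have hnot : ∀ i ≠ (⟨0, hm⟩ : Fin m), ¬ (E i).IsSolution (g i) := fun i hi H =>
      hn i (((hg i hi).2 _).2 H)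
    have hcard : ((Finset.univ : Finset (Fin m)).erase ⟨0, hm⟩).card ≤
        (E ⟨0, hm⟩).length ^ 2 := by
      rcases ((Finset.univ : Finset (Fin m)).erase ⟨0, hm⟩).eq_empty_or_nonempty with h0 | ⟨k, hk⟩
      · rw [h0]; simp
      replace hk := Finset.ne_of_mem_erase hk
      -- The witness `g k` fails `E k`, so the common solution `g₀` takes its place in the family;
      -- only the first index is lost.
      refine card_le_length_sq hE (hg k hk).1 (hsolve k hk _ hk.symm) (hnot k hk) _
        (Function.update g k g₀) ?_ ?_ ?_ ?_
      · intro i hi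
        rcases eq_or_ne i k with rfl | hik
        · rwa [Function.update_self]
        · rw [Function.update_of_ne hik]
          exact (hg i (Finset.ne_of_mem_erase hi)).1
      · intro i hi
        rcases eq_or_ne i k with rfl | hik
        · rw [Function.update_self]
          exact hs₀ _
        · rw [Function.update_of_ne hik]
          exact hsolve i (Finset.ne_of_mem_erase hi) _ (Finset.ne_of_mem_erase hi).symm
      · intro i hi
        rcases eq_or_ne i k with rfl | hik
        · rw [Function.update_self]
          exact hs₀ _
        · rw [Function.update_of_ne hik]
          exact hsolve i (Finset.ne_of_mem_erase hi) _ hik.symm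
      · intro i hi j hj H
        replace hi := Finset.ne_of_mem_erase hi
        replace hj := Finset.ne_of_mem_erase hj
        by_contra hij
        by_cases hik : i = k
        · subst hik
          have := H (E j)
          rw [Function.update_self, Function.update_of_ne (Ne.symm hij)] at this
          exact hnot j hj (this.1 (hs₀ j))
        · have := H (E i)
          rw [Function.update_of_ne hik] at this
          apply hnot i hi
          rw [this]
          rcases eq_or_ne j k with rfl | hjk
          · rw [Function.update_self]
            exact hs₀ i
          · rw [Function.update_of_ne hjk]
            exact hsolve j hj i hij
    rw [Finset.card_erase_of_mem (Finset.mem_univ _), Finset.card_univ, Fintype.card_fin] at hcard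
    omega

end WordEquation

theorem mainTheorem3 {α : Type*} {m : ℕ} (hm : 0 < m) (E : Fin m → WordEquation 3) :
    (WordEquation.IsIndependentSystem α E →
      (∃ h : FreeMonoid (Fin 3) →* FreeMonoid α,
        (∀ i, (E i).IsSolution h) ∧ ¬ WordEquation.IsPeriodic h) →
      m ≤ (E ⟨0, hm⟩).length ^ 2 + 1) ∧
    (WordEquation.IsChainOfEquations α E → m ≤ (E ⟨0, hm⟩).length ^ 2 + 5) :=
  ⟨fun hc ⟨_, hs, hp⟩ => hc.le_length_sq_add hm hs hp, fun hc => hc.le_length_sq_add hm⟩
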